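/- Let $k\ge 3$ be an integer, let $S_k$ be the finite-dimensional complex vector space of holomorphic cusp forms of weight $k$ for $\mathrm{SL}_2(\mathbb Z)$, and for $n\ge 1$ let $T_k(n)\colon S_k\to S_k$ be the $n$-th Hecke operator $$(T_k(n)f)(z)=n^{-\frac{k-1}{2}}\cdot n^{k-1}\sum_{\substack{ad=n\\ a,d\ge 1}}\ \sum_{0\le b<d} d^{-k} f\!\left(\frac{az+b}{d}\right),$$ that is, the classical Hecke operator multiplied by $n^{-(k-1)/2}$, the normalization in which the Ramanujan conjecture reads $\operatorname{tr}T_k(n)=O_{k,\epsilon}(n^{\epsilon})$ for every $\epsilon>0$. Then for every $\epsilon>0$ there is a constant $C$, depending only on $k$ and $\epsilon$, such that for every real $X>0$ $$\Bigl|\sum_{1\le n<X}\operatorname{tr}T_k(n)\Bigr|\le C\,X^{\frac{31}{32}+\epsilon}.$$ -/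

import Mathlib

noncomputable section

open UpperHalfPlane Matrix ModularGroup FixedDetMatrices
open scoped ModularForm MatrixGroups Manifold

namespace HeckeLevelOne

/-- An integral `2 × 2` matrix of nonzero determinant `m`, as an element of `GL₂(ℝ)`. -/
def toGL {m : ℤ} (hm : m ≠ 0) (A : FixedDetMatrix (Fin 2) ℤ m) : GL (Fin 2) ℝ :=
  GeneralLinearGroup.mkOfDetNeZero (A.1.map (Int.cast : ℤ → ℝ)) (by
    have h : (A.1.map (Int.cast : ℤ → ℝ)).det = ((A.1.det : ℤ) : ℝ) := by
      simp [Matrix.det_fin_two]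
    rw [h, A.2]
    exact_mod_cast hm)

lemma toGL_apply {m : ℤ} (hm : m ≠ 0) (A : FixedDetMatrix (Fin 2) ℤ m) (i j : Fin 2) :
    (toGL hm A) i j = (A.1 i j : ℝ) := rfl

lemma toGL_det {m : ℤ} (hm : m ≠ 0) (A : FixedDetMatrix (Fin 2) ℤ m) :
    (toGL hm A).det.val = (m : ℝ) := by
  have h : (A.1.map (Int.cast : ℤ → ℝ)).det = ((A.1.det : ℤ) : ℝ) := by
    simp [Matrix.det_fin_two]
  exact h.trans (by rw [A.2])

lemma toGL_smul {m : ℤ} (hm : m ≠ 0) (g : SL(2, ℤ)) (A : FixedDetMatrix (Fin 2) ℤ m) :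
    toGL hm (g • A) = SpecialLinearGroup.mapGL ℝ g * toGL hm A := by
  ext i j
  simp [toGL_apply, smul_coe, Matrix.mul_apply, Fin.sum_univ_two]

/-- Right multiplication by `SL₂(ℤ)` on integral matrices of determinant `m`. -/
def mulRight {m : ℤ} (A : FixedDetMatrix (Fin 2) ℤ m) (g : SL(2, ℤ)) :
    FixedDetMatrix (Fin 2) ℤ m :=
  ⟨A.1 * g.1, by rw [Matrix.det_mul, A.2, g.2, mul_one]⟩

lemma toGL_mulRight {m : ℤ} (hm : m ≠ 0) (A : FixedDetMatrix (Fin 2) ℤ m) (g : SL(2, ℤ)) :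
    toGL hm (mulRight A g) = toGL hm A * SpecialLinearGroup.mapGL ℝ g := by
  ext i j
  rw [toGL_apply, mulRight]
  simp [toGL_apply, Matrix.mul_apply, Fin.sum_univ_two]

lemma mulRight_inv {m : ℤ} (A : FixedDetMatrix (Fin 2) ℤ m) (g : SL(2, ℤ)) :
    mulRight (mulRight A g) g⁻¹ = A := by
  have hg : (g : Matrix (Fin 2) (Fin 2) ℤ) * ((g⁻¹ : SL(2, ℤ)) : Matrix (Fin 2) (Fin 2) ℤ) = 1 :=
    congrArg Subtype.val (mul_inv_cancel g)
  apply FixedDetMatrices.ext'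
  change A.1 * (g : Matrix (Fin 2) (Fin 2) ℤ) * ((g⁻¹ : SL(2, ℤ)) : Matrix (Fin 2) (Fin 2) ℤ) = A.1
  rw [Matrix.mul_assoc, hg, Matrix.mul_one]

lemma smul_mulRight {m : ℤ} (h : SL(2, ℤ)) (A : FixedDetMatrix (Fin 2) ℤ m) (g : SL(2, ℤ)) :
    h • mulRight A g = mulRight (h • A) g := by
  apply FixedDetMatrices.ext'
  exact (Matrix.mul_assoc _ _ _).symm

lemma exists_smul_eq_reduce {m : ℤ} (A : FixedDetMatrix (Fin 2) ℤ m) :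
    ∃ g : SL(2, ℤ), reduce A = g • A := by
  induction A using reduce_rec with
  | base A h =>
    by_cases h1 : 0 < A.1 0 0
    · exact ⟨_, reduce_of_pos h h1⟩
    · exact ⟨T ^ (-(-A.1 0 1 / -A.1 1 1)) * (S * S), by
        rw [reduce_of_not_pos h h1, mul_smul, mul_smul]⟩
  | step A h ih =>
    obtain ⟨g, hg⟩ := ih
    refine ⟨g * (S * T ^ (-(A.1 0 0 / A.1 1 0))), ?_⟩
    rw [← reduce_reduceStep h, hg, reduceStep, mul_smul, mul_smul]

/-- Distinct elements of `reps m` lie in distinct left `SL₂(ℤ)`-orbits. -/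
lemma eq_of_mem_reps {m : ℤ} (hm : 0 < m) {A B : FixedDetMatrix (Fin 2) ℤ m} (hA : A ∈ reps m)
    (hB : B ∈ reps m) (g : SL(2, ℤ)) (h : g • A = B) : A = B := by
  obtain ⟨a10, a00, a01, a11⟩ := hA
  obtain ⟨b10, b00, b01, b11⟩ := hB
  have dA := A.2
  have dB := B.2
  have dg := g.2
  rw [Matrix.det_fin_two] at dA dB dg
  have hB1 : B.1 = g.1 * A.1 := by rw [← h, smul_coe]
  have e00 : B.1 0 0 = g.1 0 0 * A.1 0 0 + g.1 0 1 * A.1 1 0 := by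
    rw [hB1]; simp [Matrix.mul_apply, Fin.sum_univ_two]
  have e01 : B.1 0 1 = g.1 0 0 * A.1 0 1 + g.1 0 1 * A.1 1 1 := by
    rw [hB1]; simp [Matrix.mul_apply, Fin.sum_univ_two]
  have e10 : B.1 1 0 = g.1 1 0 * A.1 0 0 + g.1 1 1 * A.1 1 0 := by
    rw [hB1]; simp [Matrix.mul_apply, Fin.sum_univ_two]
  have e11 : B.1 1 1 = g.1 1 0 * A.1 0 1 + g.1 1 1 * A.1 1 1 := by
    rw [hB1]; simp [Matrix.mul_apply, Fin.sum_univ_two]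
  rw [a10, mul_zero, add_zero] at e00 e10
  rw [a10, mul_zero, sub_zero] at dA
  rw [b10] at e10
  have g10 : g.1 1 0 = 0 := by
    rcases mul_eq_zero.mp e10.symm with h | h
    · exact h
    · exact absurd h a00.ne'
  rw [g10, mul_zero, sub_zero] at dg
  rw [g10, zero_mul, zero_add] at e11
  have g00pos : 0 < g.1 0 0 := by
    rw [e00] at b00
    exact pos_of_mul_pos_left b00 a00.le
  have g00 : g.1 0 0 = 1 := by
    rcases Int.mul_eq_one_iff_eq_one_or_neg_one.mp dg with h | h <;> omega
  have g11 : g.1 1 1 = 1 := by rw [g00, one_mul] at dg; exact dg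
  rw [g00, one_mul] at e00 e01
  rw [g11, one_mul] at e11
  have ad : 0 < A.1 1 1 := by
    have : 0 < A.1 0 0 * A.1 1 1 := by rw [dA]; exact hm
    exact pos_of_mul_pos_right this a00.le
  rw [e11, abs_of_nonneg b01, abs_of_pos ad] at b11
  rw [abs_of_nonneg a01, abs_of_pos ad] at a11
  have g01 : g.1 0 1 = 0 := by
    by_contra hne
    rcases lt_or_gt_of_ne hne with h | h <;> nlinarith
  rw [g01, zero_mul, add_zero] at e01
  apply FixedDetMatrices.ext
  intro i j
  fin_cases i <;> fin_cases j
  · exact e00.symm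
  · exact e01.symm
  · exact a10.trans b10.symm
  · exact e11.symm

lemma ne_zero_of_mem_reps {n : ℕ} (A : reps (n : ℤ)) : (n : ℤ) ≠ 0 := by
  intro h
  obtain ⟨A, hA⟩ := A
  revert A
  rw [h]
  simp

/-- The classical (unnormalized) Hecke sum
`∑_A f ∣[k] A = n ^ (k - 1) * ∑_{a d = n, 0 ≤ b < d} d ^ (-k) * f ((a z + b) / d)`,
where `A` runs through the set `reps n` of matrices `!![a, b; 0, d]` with `a, d > 0`, `a d = n` and
`0 ≤ b < d`, which represent `SL₂(ℤ) \ {A ∈ M₂(ℤ) : det A = n}`. Mathlib's slash action carries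
the factor `|det A| ^ (k - 1)`. -/
def heckeSum (k : ℤ) (n : ℕ) (f : ℍ → ℂ) : ℍ → ℂ :=
  ∑ A : reps (n : ℤ), f ∣[k] toGL (ne_zero_of_mem_reps A) A.1

lemma slash_reduce {m : ℤ} (hm : m ≠ 0) {k : ℤ} (f : CuspForm 𝒮ℒ k)
    (A : FixedDetMatrix (Fin 2) ℤ m) :
    (f : ℍ → ℂ) ∣[k] toGL hm (reduce A) = (f : ℍ → ℂ) ∣[k] toGL hm A := by
  obtain ⟨g, hg⟩ := exists_smul_eq_reduce A
  rw [hg, toGL_smul, SlashAction.slash_mul,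
    SlashInvariantFormClass.slash_action_eq f _ (MonoidHom.mem_range.mpr ⟨g, rfl⟩)]

lemma heckeSum_slash {k : ℤ} (n : ℕ) (f : CuspForm 𝒮ℒ k) (g : SL(2, ℤ)) :
    heckeSum k n f ∣[k] (SpecialLinearGroup.mapGL ℝ g) = heckeSum k n f := by
  rcases Nat.eq_zero_or_pos n with rfl | hn
  · have : IsEmpty (reps ((0 : ℕ) : ℤ)) := ⟨fun A => ne_zero_of_mem_reps A rfl⟩
    simp [heckeSum]
  have hm : (n : ℤ) ≠ 0 := by exact_mod_cast hn.ne'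
  let φ : reps (n : ℤ) → reps (n : ℤ) := fun A =>
    ⟨reduce (mulRight A.1 g), reduce_mem_reps hm _⟩
  have hφ : Function.Injective φ := by
    intro A B hAB
    have h : reduce (mulRight A.1 g) = reduce (mulRight B.1 g) := congrArg Subtype.val hAB
    obtain ⟨p, hp⟩ := exists_smul_eq_reduce (mulRight A.1 g)
    obtain ⟨q, hq⟩ := exists_smul_eq_reduce (mulRight B.1 g)
    rw [hp, hq] at h
    have h2 : (q⁻¹ * p) • mulRight A.1 g = mulRight B.1 g := by
      rw [mul_smul, h, inv_smul_smul]
    apply Subtype.ext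
    refine eq_of_mem_reps (by exact_mod_cast hn) A.2 B.2 (q⁻¹ * p) ?_
    rw [← mulRight_inv ((q⁻¹ * p) • A.1) g, ← smul_mulRight, h2, mulRight_inv]
  have hbij : Function.Bijective φ := Finite.injective_iff_bijective.mp hφ
  rw [heckeSum, SlashAction.sum_slash]
  refine Fintype.sum_bijective φ hbij _ _ fun A => ?_
  rw [← SlashAction.slash_mul, ← toGL_mulRight, ← slash_reduce]

lemma heckeSum_isZeroAtImInfty {k : ℤ} (n : ℕ) (f : CuspForm 𝒮ℒ k) :
    IsZeroAtImInfty (heckeSum k n f) := by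
  have hf : IsZeroAtImInfty (f : ℍ → ℂ) :=
    OnePoint.isZeroAt_infty_iff.mp
      (f.zero_at_cusps' (isCusp_SL2Z_iff'.mpr ⟨1, by simp⟩))
  rw [heckeSum, IsZeroAtImInfty, Filter.ZeroAtFilter, Finset.sum_fn,
    show (0 : ℂ) = ∑ A : reps (n : ℤ), 0 by simp]
  refine tendsto_finsetSum _ fun A _ => hf.slash k ?_
  rw [toGL_apply, A.2.1, Int.cast_zero]

/-- The classical (unnormalized) Hecke operator `f ↦ heckeSum k n f` on cusp forms of level one,
as a cusp form. -/
def heckeCuspForm {k : ℤ} (n : ℕ) (f : CuspForm 𝒮ℒ k) : CuspForm 𝒮ℒ k where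
  toFun := heckeSum k n f
  slash_action_eq' := by
    rintro _ ⟨g, rfl⟩
    exact heckeSum_slash n f g
  holo' := .sum fun A _ => f.holo'.slash k _
  zero_at_cusps' := by
    intro c hc
    obtain ⟨g, rfl⟩ := isCusp_SL2Z_iff'.mp hc
    rw [OnePoint.IsZeroAt.smul_iff, heckeSum_slash, OnePoint.isZeroAt_infty_iff]
    exact heckeSum_isZeroAtImInfty n f

lemma heckeSum_smul (k : ℤ) (n : ℕ) (c : ℂ) (f : ℍ → ℂ) :
    heckeSum k n (c • f) = c • heckeSum k n f := by
  simp only [heckeSum, Finset.smul_sum]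
  refine Finset.sum_congr rfl fun A _ => ?_
  have hpos : 0 < (toGL (ne_zero_of_mem_reps A) A.1).det.val := by
    rw [toGL_det]
    have := ne_zero_of_mem_reps A
    have : 0 < (n : ℤ) := by omega
    exact_mod_cast this
  rw [ModularForm.smul_slash, σ, if_pos hpos]
  rfl

/-- The space `S_k` of holomorphic cusp forms of weight `k` for the full modular group. -/
abbrev CuspSpace (k : ℤ) : Type := CuspForm 𝒮ℒ k

/-- The `n`-th Hecke operator `T_k(n)` on the space of level-one weight-`k` cusp forms, normalized
by the factor `n ^ (-(k - 1) / 2)`. -/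
def heckeOperator (k : ℤ) (n : ℕ) : CuspSpace k →ₗ[ℂ] CuspSpace k where
  toFun f := (((n : ℝ) ^ (-(((k : ℝ) - 1) / 2)) : ℝ) : ℂ) • heckeCuspForm n f
  map_add' f g := by
    rw [← smul_add]
    congr 1
    refine DFunLike.coe_injective ?_
    change heckeSum k n (f + g : ℍ → ℂ) = heckeSum k n f + heckeSum k n g
    simp [heckeSum, Finset.sum_add_distrib]
  map_smul' c f := by
    rw [RingHom.id_apply, smul_comm c]
    congr 1
    refine DFunLike.coe_injective ?_
    exact heckeSum_smul k n c f

end HeckeLevelOne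

end

open UpperHalfPlane Matrix ModularGroup FixedDetMatrices
open scoped ModularForm MatrixGroups Manifold

namespace HeckeLevelOne

/-! The trace of `T_k(n)` is the sum of its diagonal coordinates in a basis. By the Sturm bound,
each coordinate functional is a combination of finitely many q-expansion coefficients. For `f = ∑
c(l) q^l`, the `m`-th coefficient of the unnormalized Hecke image is the sum of `a^(k-1) c(mn/a²)`
over the common divisors `a` of `m` and `n`. It therefore suffices to bound the sums of `c(mn)` over
`n < N`, for fixed `f` and `m`.

This is `sumBound_qExpansion_coeff`, by Hecke's argument. The sum is an integral over one period, at
height `1/N`, of `f` against a geometric sum in `q^(-m)`. There `f` is `O(N^(k/2))`, while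
`norm_sum_Ico_pow_le` bounds the kernel by `N^(1/4)` times an integrable function. This gives
`N^(k/2+1/4)`. Partial summation against `n^(-(k-1)/2)` leaves `N^(3/4)`, and `3/4 < 31/32`. -/

/-- The partial sums of `u` over `1 ≤ n < N` are `O(N ^ e)`, uniformly in `N`. -/
def SumBound (e : ℝ) (u : ℕ → ℂ) : Prop :=
  ∃ C : ℝ, 0 ≤ C ∧ ∀ N : ℕ, ‖∑ n ∈ Finset.Ico 1 N, u n‖ ≤ C * (N : ℝ) ^ e

/-! ### Stability of power bounds on partial sums -/

namespace SumBound

variable {e : ℝ} {u : ℕ → ℂ}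

lemma const_mul (h : SumBound e u) (c : ℂ) : SumBound e (fun n => c * u n) := by
  obtain ⟨C, hC, h⟩ := h
  refine ⟨‖c‖ * C, by positivity, fun N => ?_⟩
  rw [← Finset.mul_sum, norm_mul, mul_assoc]
  exact mul_le_mul_of_nonneg_left (h N) (norm_nonneg c)

lemma sum {ι : Type*} {s : Finset ι} {v : ι → ℕ → ℂ} (h : ∀ i ∈ s, SumBound e (v i)) :
    SumBound e (fun n => ∑ i ∈ s, v i n) := by
  choose! C hC h using h
  refine ⟨∑ i ∈ s, C i, Finset.sum_nonneg hC, fun N => ?_⟩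
  rw [Finset.sum_comm, Finset.sum_mul]
  exact norm_sum_le_of_le s fun i hi => h i hi N

lemma congr {v : ℕ → ℂ} (h : SumBound e u) (huv : ∀ n, 1 ≤ n → v n = u n) : SumBound e v := by
  obtain ⟨C, hC, h⟩ := h
  refine ⟨C, hC, fun N => ?_⟩
  rw [Finset.sum_congr rfl fun n hn => huv n (Finset.mem_Ico.mp hn).1]
  exact h N

/-- Spreading a sequence out over the multiples of `a` preserves bounds on its partial sums. -/
lemma dilate (h : SumBound e u) (he : 0 ≤ e) {a : ℕ} (ha : 0 < a) :
    SumBound e (fun n => if a ∣ n then u (n / a) else 0) := by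
  obtain ⟨C, hC, h⟩ := h
  refine ⟨C, hC, fun N => ?_⟩
  -- The new cut-off is `N / a` rounded up: `a * b < N` exactly when `b` lies below it.
  have key : ∑ n ∈ Finset.Ico 1 N, (if a ∣ n then u (n / a) else 0) =
      ∑ n ∈ Finset.Ico 1 ((N + a - 1) / a), u n := by
    rw [← Finset.sum_filter]
    refine Finset.sum_nbij' (fun n => n / a) (fun n => a * n) ?_ ?_ ?_ ?_ ?_
    · intro n hn
      simp only [Finset.mem_filter, Finset.mem_Ico] at hn
      obtain ⟨⟨h1, h2⟩, b, rfl⟩ := hn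
      have hb : 0 < b := Nat.pos_of_mul_pos_left h1
      simp only [Finset.mem_Ico, Nat.mul_div_cancel_left b ha]
      refine ⟨hb, ?_⟩
      rw [Nat.lt_iff_add_one_le, Nat.le_div_iff_mul_le ha]
      have : (b + 1) * a = a * b + a := by ring
      omega
    · intro n hn
      simp only [Finset.mem_Ico] at hn
      have h2 := hn.2
      rw [Nat.lt_iff_add_one_le, Nat.le_div_iff_mul_le ha] at h2
      have h3 : (n + 1) * a = a * n + a := by ring
      have h4 : 0 < a * n := Nat.mul_pos ha hn.1
      simp only [Finset.mem_filter, Finset.mem_Ico, dvd_mul_right, and_true]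
      omega
    · intro n hn
      exact Nat.mul_div_cancel' (Finset.mem_filter.mp hn).2
    · intro n _
      exact Nat.mul_div_cancel_left n ha
    · intro n _
      rfl
  rw [key]
  refine (h _).trans (mul_le_mul_of_nonneg_left ?_ hC)
  refine Real.rpow_le_rpow (by positivity) ?_ he
  rcases Nat.eq_zero_or_pos N with rfl | hN
  · rw [Nat.div_eq_of_lt (by omega)]
  · have : (N + a - 1) / a ≤ N := by
      refine Nat.div_le_of_le_mul ?_
      have : a + N ≤ a * N + 1 := by nlinarith
      omega
    exact_mod_cast this

lemma rpow_neg_sub_le {s : ℝ} (hs : 0 ≤ s) {n : ℕ} (hn : 1 ≤ n) :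
    (n : ℝ) ^ (-s) - ((n + 1 : ℕ) : ℝ) ^ (-s) ≤ s * (n : ℝ) ^ (-s - 1) := by
  have hn0 : (0 : ℝ) < n := by exact_mod_cast hn
  have hlog : Real.log ((n + 1 : ℝ) / n) ≤ 1 / n := by
    refine (Real.log_le_sub_one_of_pos (by positivity)).trans (le_of_eq ?_)
    field_simp
    ring
  have h1 : 1 - s / n ≤ ((n + 1 : ℝ) / n) ^ (-s) := by
    rw [Real.rpow_def_of_pos (by positivity)]
    refine le_trans ?_ (Real.add_one_le_exp _)
    have : s * Real.log ((n + 1 : ℝ) / n) ≤ s * (1 / n) := mul_le_mul_of_nonneg_left hlog hs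
    rw [mul_one_div] at this
    linarith
  have h2 : ((n + 1 : ℕ) : ℝ) ^ (-s) = (n : ℝ) ^ (-s) * ((n + 1 : ℝ) / n) ^ (-s) := by
    rw [← Real.mul_rpow (by positivity) (by positivity)]
    congr 1
    push_cast
    field_simp
  rw [h2, Real.rpow_sub_one hn0.ne']
  have h3 : 0 < (n : ℝ) ^ (-s) := by positivity
  have := mul_le_mul_of_nonneg_left h1 h3.le
  have h4 : s * ((n : ℝ) ^ (-s) / n) = (n : ℝ) ^ (-s) * (s / n) := by ring
  rw [h4]
  linarith

/-- Bernoulli's inequality for the concave power `δ`. It dominates the terms left by Abel summation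
by increments that telescope. -/
lemma mul_rpow_sub_one_le {δ : ℝ} (h0 : 0 ≤ δ) (h1 : δ ≤ 1) (n : ℕ) :
    δ * ((n + 1 : ℕ) : ℝ) ^ (δ - 1) ≤ ((n + 1 : ℕ) : ℝ) ^ δ - (n : ℝ) ^ δ := by
  have hp : (0 : ℝ) < ((n + 1 : ℕ) : ℝ) := by positivity
  have h2 : (1 + (-(1 / ((n + 1 : ℕ) : ℝ)))) ^ δ ≤ 1 + δ * (-(1 / ((n + 1 : ℕ) : ℝ))) := by
    refine _root_.rpow_one_add_le_one_add_mul_self ?_ h0 h1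
    rw [neg_le_neg_iff, div_le_one hp]
    simp
  have h3 : (n : ℝ) ^ δ = ((n + 1 : ℕ) : ℝ) ^ δ * (1 + (-(1 / ((n + 1 : ℕ) : ℝ)))) ^ δ := by
    rw [← Real.mul_rpow hp.le]
    · congr 1
      field_simp
      push_cast
      ring
    · rw [← sub_eq_add_neg, sub_nonneg, div_le_one hp]
      simp
  have h4 := mul_le_mul_of_nonneg_left h2 (Real.rpow_nonneg hp.le δ)
  rw [← h3] at h4
  rw [Real.rpow_sub_one hp.ne']
  have h5 : δ * (((n + 1 : ℕ) : ℝ) ^ δ / ((n + 1 : ℕ) : ℝ)) =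
    ((n + 1 : ℕ) : ℝ) ^ δ * (δ * (1 / ((n + 1 : ℕ) : ℝ))) := by ring
  rw [h5]
  linarith

lemma sum_mul_by_parts (w u : ℕ → ℂ) (N : ℕ) :
    ∑ n ∈ Finset.Ico 1 (N + 1), w n * u n =
      w (N + 1) * ∑ n ∈ Finset.Ico 1 (N + 1), u n +
        ∑ n ∈ Finset.range N, (w (n + 1) - w (n + 2)) * ∑ j ∈ Finset.Ico 1 (n + 2), u j := by
  induction N with
  | zero => simp
  | succ N ih =>
    rw [Finset.sum_Ico_succ_top (by omega), ih, Finset.sum_range_succ,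
      Finset.sum_Ico_succ_top (by omega : 1 ≤ N + 1)]
    ring

/-- Partial summation against the weights `n ^ (-s)`. -/
lemma rpow_mul (h : SumBound e u) {s : ℝ} (hs : 0 ≤ s) (h0 : s < e) (h1 : e ≤ s + 1) :
    SumBound (e - s) (fun n => (((n : ℝ) ^ (-s) : ℝ) : ℂ) * u n) := by
  obtain ⟨C, hC, h⟩ := h
  have hδ : 0 < e - s := by linarith
  refine ⟨C + C * (s * 2 ^ e) / (e - s), by positivity, fun N => ?_⟩
  rcases N with _ | N
  · simp only [zero_le, Finset.Ico_eq_empty_of_le, Finset.sum_empty, norm_zero]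
    positivity
  rw [sum_mul_by_parts, add_mul]
  refine (norm_add_le _ _).trans (add_le_add ?_ ?_)
  · rw [norm_mul, Complex.norm_real, Real.norm_of_nonneg (by positivity)]
    calc ((N + 1 : ℕ) : ℝ) ^ (-s) * ‖∑ n ∈ Finset.Ico 1 (N + 1), u n‖
        ≤ ((N + 1 : ℕ) : ℝ) ^ (-s) * (C * ((N + 1 : ℕ) : ℝ) ^ e) :=
          mul_le_mul_of_nonneg_left (h _) (by positivity)
      _ = C * ((N + 1 : ℕ) : ℝ) ^ (e - s) := by
          rw [mul_left_comm, ← Real.rpow_add (by positivity), neg_add_eq_sub]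
  -- The weight difference is at most `s * (n+1)^(-s-1)` and the partial sum is `O((n+2)^e)`. The
  -- factor `2 ^ e` comes from `n + 2 ≤ 2 * (n + 1)`, and `1 / (e - s)` from comparison with a
  -- telescoping increment.
  · have hterm : ∀ n : ℕ, ‖((((n + 1 : ℕ) : ℝ) ^ (-s) : ℝ) - ((((n + 2 : ℕ) : ℝ) ^ (-s) : ℝ) : ℂ)) *
        ∑ j ∈ Finset.Ico 1 (n + 2), u j‖ ≤
        C * (s * 2 ^ e) / (e - s) * (((n + 1 : ℕ) : ℝ) ^ (e - s) - (n : ℝ) ^ (e - s)) := by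
      intro n
      have hp : (0 : ℝ) < ((n + 1 : ℕ) : ℝ) := by positivity
      have hw := rpow_neg_sub_le hs (n := n + 1) (by omega)
      have hw0 : ((n + 2 : ℕ) : ℝ) ^ (-s) ≤ ((n + 1 : ℕ) : ℝ) ^ (-s) :=
        Real.rpow_le_rpow_of_nonpos hp (by push_cast; linarith) (by linarith)
      rw [norm_mul, ← Complex.ofReal_sub, Complex.norm_real, Real.norm_of_nonneg (by linarith)]
      calc _ ≤ (s * ((n + 1 : ℕ) : ℝ) ^ (-s - 1)) * (C * ((n + 2 : ℕ) : ℝ) ^ e) :=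
            mul_le_mul hw (h _) (norm_nonneg _) (by positivity)
        _ ≤ (s * ((n + 1 : ℕ) : ℝ) ^ (-s - 1)) * (C * (2 ^ e * ((n + 1 : ℕ) : ℝ) ^ e)) := by
            rw [← Real.mul_rpow zero_le_two hp.le]
            gcongr
            · linarith
            · push_cast
              linarith [(Nat.cast_nonneg n : (0 : ℝ) ≤ n)]
        _ = C * (s * 2 ^ e) / (e - s) * ((e - s) * ((n + 1 : ℕ) : ℝ) ^ (e - s - 1)) := by
            have : ((n + 1 : ℕ) : ℝ) ^ (e - s - 1) =
                ((n + 1 : ℕ) : ℝ) ^ (-s - 1) * ((n + 1 : ℕ) : ℝ) ^ e := by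
              rw [← Real.rpow_add hp]
              ring_nf
            rw [this]
            field_simp
        _ ≤ _ := mul_le_mul_of_nonneg_left
            (mul_rpow_sub_one_le hδ.le (by linarith) n) (by positivity)
    refine (norm_sum_le_of_le _ fun n _ => hterm n).trans ?_
    rw [← Finset.mul_sum, Finset.sum_range_sub (fun n : ℕ => (n : ℝ) ^ (e - s))]
    refine mul_le_mul_of_nonneg_left ?_ (by positivity)
    rw [Nat.cast_zero, Real.zero_rpow hδ.ne', sub_zero]
    exact Real.rpow_le_rpow (by positivity) (by push_cast; linarith) hδ.le

end SumBound

/-! ### The geometric kernel and coefficient sums -/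

/-- The zeros of the sine are simple and `3/4 < 1`. Jordan's inequality handles `[0, 1/2]`;
reflection and periodicity do the rest. -/
lemma intervalIntegrable_abs_sin_pi_rpow :
    ∀ a b : ℝ, IntervalIntegrable (fun x : ℝ => |Real.sin (Real.pi * x)| ^ (-(3 / 4) : ℝ))
      MeasureTheory.volume a b := by
  have hpi := Real.pi_pos
  have hmeas : Measurable fun x : ℝ => |Real.sin (Real.pi * x)| ^ (-(3 / 4) : ℝ) := by fun_prop
  have hhalf : IntervalIntegrable (fun x : ℝ => |Real.sin (Real.pi * x)| ^ (-(3 / 4) : ℝ))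
      MeasureTheory.volume 0 (1 / 2) := by
    refine IntervalIntegrable.mono_fun'
      (intervalIntegral.intervalIntegrable_rpow' (r := -(3 / 4)) (by norm_num))
      hmeas.aestronglyMeasurable ?_
    refine (MeasureTheory.ae_restrict_iff' measurableSet_uIoc).mpr (.of_forall fun x hx => ?_)
    rw [Set.uIoc_of_le (by norm_num)] at hx
    have hsin := Real.mul_le_sin (x := Real.pi * x) (by nlinarith [hx.1]) (by nlinarith [hx.2])
    rw [← mul_assoc, div_mul_cancel₀ _ hpi.ne'] at hsin
    have hx' : x ≤ |Real.sin (Real.pi * x)| := by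
      refine le_trans ?_ (le_abs_self _)
      linarith [hx.1]
    refine (Real.norm_of_nonneg (by positivity)).trans_le ?_
    exact Real.rpow_le_rpow_of_nonpos hx.1 hx' (by norm_num)
  have hone : IntervalIntegrable (fun x : ℝ => |Real.sin (Real.pi * x)| ^ (-(3 / 4) : ℝ))
      MeasureTheory.volume (0 : ℝ) 1 := by
    refine hhalf.trans ?_
    have h := (hhalf.comp_sub_left 1).symm
    simp only [mul_sub, mul_one, Real.sin_pi_sub] at h
    norm_num at h ⊢
    exact h
  refine Function.Periodic.intervalIntegrable₀ (fun x => ?_) one_ne_zero hone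
  rw [mul_add, mul_one, Real.sin_add_pi, abs_neg]

/-- By the law of cosines the squared norm is `(r - 1)² + 4 r sin² θ`. -/
lemma two_mul_abs_sin_le_norm_sub_one {r : ℝ} (hr : 1 ≤ r) (θ : ℝ) :
    2 * |Real.sin θ| ≤ ‖(r : ℂ) * Complex.exp (((2 * θ : ℝ) : ℂ) * Complex.I) - 1‖ := by
  refine (sq_le_sq₀ (by positivity) (norm_nonneg _)).mp ?_
  rw [← Complex.normSq_eq_norm_sq, Complex.normSq_apply]
  simp only [Complex.sub_re, Complex.sub_im, Complex.re_ofReal_mul, Complex.im_ofReal_mul,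
    Complex.exp_ofReal_mul_I_re, Complex.exp_ofReal_mul_I_im, Complex.one_re, Complex.one_im]
  rw [mul_pow, sq_abs, Real.cos_two_mul', Real.sin_two_mul]
  have h := Real.sin_sq_add_cos_sq θ
  have hc : Real.cos θ ^ 2 = 1 - Real.sin θ ^ 2 := by linarith
  have key : (r * (Real.cos θ ^ 2 - Real.sin θ ^ 2) - 1) * (r * (Real.cos θ ^ 2 - Real.sin θ ^ 2) - 1)
      + (r * (2 * Real.sin θ * Real.cos θ) - 0) * (r * (2 * Real.sin θ * Real.cos θ) - 0)
      = (r - 1) ^ 2 + 4 * r * Real.sin θ ^ 2 := by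
    have : (r * (2 * Real.sin θ * Real.cos θ) - 0) * (r * (2 * Real.sin θ * Real.cos θ) - 0) =
      r ^ 2 * 4 * Real.sin θ ^ 2 * Real.cos θ ^ 2 := by ring
    rw [this, hc]
    ring
  rw [key]
  nlinarith [sq_nonneg (r - 1), sq_nonneg (Real.sin θ)]

/-- Interpolation, with weights `1/4` and `3/4`, between the trivial bound `R * N` and the bound `R
/ s` from the closed form of the geometric sum. A weight below `1` on the second keeps the
singularities in `s` integrable. -/
lemma norm_sum_Ico_pow_le {w : ℂ} (hw : 1 ≤ ‖w‖) {N : ℕ} (hN : 1 ≤ N) {R : ℝ} (hR : ‖w‖ ^ N ≤ R)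
    {s : ℝ} (hs : 0 < s) (hws : 2 * s ≤ ‖w - 1‖) :
    ‖∑ n ∈ Finset.Ico 1 N, w ^ n‖ ≤ R * (N : ℝ) ^ (1 / 4 : ℝ) * s ^ (-(3 / 4) : ℝ) := by
  set D := ‖∑ n ∈ Finset.Ico 1 N, w ^ n‖ with hD
  have hR0 : 0 ≤ R := le_trans (by positivity) hR
  have hpow : ∀ n ≤ N, ‖w ^ n‖ ≤ R := fun n hn => by
    rw [norm_pow]
    exact (pow_le_pow_right₀ hw hn).trans hR
  have h1 : D ≤ R * N := by
    calc D ≤ ∑ n ∈ Finset.Ico 1 N, R :=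
          norm_sum_le_of_le _ fun n hn => hpow n (Finset.mem_Ico.mp hn).2.le
      _ = ((N - 1 : ℕ) : ℝ) * R := by simp
      _ ≤ R * N := by
          rw [mul_comm]
          exact mul_le_mul_of_nonneg_left (by exact_mod_cast Nat.sub_le N 1) hR0
  have h2 : D ≤ R / s := by
    have h := congrArg norm (geom_sum_Ico_mul w hN)
    rw [norm_mul, ← hD] at h
    have h3 : ‖w ^ N - w ^ 1‖ ≤ R + R :=
      (norm_sub_le _ _).trans (add_le_add (hpow N le_rfl) (hpow 1 hN))
    rw [le_div_iff₀ hs]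
    have := mul_le_mul_of_nonneg_left hws (norm_nonneg (∑ n ∈ Finset.Ico 1 N, w ^ n))
    rw [← hD] at this
    linarith
  have hD0 : 0 ≤ D := norm_nonneg _
  calc D = D ^ (1 / 4 : ℝ) * D ^ (3 / 4 : ℝ) := by
        rw [← Real.rpow_add_of_nonneg hD0 (by norm_num) (by norm_num)]
        norm_num
    _ ≤ (R * N) ^ (1 / 4 : ℝ) * (R / s) ^ (3 / 4 : ℝ) := by gcongr
    _ = (R ^ (1 / 4 : ℝ) * R ^ (3 / 4 : ℝ)) * (N : ℝ) ^ (1 / 4 : ℝ) * s ^ (-(3 / 4) : ℝ) := by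
        rw [Real.mul_rpow hR0 (by positivity), Real.div_rpow hR0 hs.le, Real.rpow_neg hs.le]
        ring
    _ = R * (N : ℝ) ^ (1 / 4 : ℝ) * s ^ (-(3 / 4) : ℝ) := by
        rw [← Real.rpow_add_of_nonneg hR0 (by norm_num) (by norm_num)]
        norm_num

lemma one_div_qParam_pow (m : ℕ) (x t : ℝ) :
    1 / Function.Periodic.qParam 1 ((x : ℂ) + t * Complex.I) ^ m =
      (Real.exp (2 * Real.pi * m * t) : ℂ) *
        Complex.exp (((2 * (-(Real.pi * (m * x))) : ℝ) : ℂ) * Complex.I) := by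
  rw [Function.Periodic.qParam, ← Complex.exp_nat_mul, one_div, ← Complex.exp_neg,
    Complex.ofReal_exp, ← Complex.exp_add]
  congr 1
  push_cast
  linear_combination (-2 * Real.pi * m * t : ℂ) * Complex.I_sq

lemma ae_sin_pi_mul_ne_zero {m : ℕ} (hm : 0 < m) :
    ∀ᵐ x : ℝ, Real.sin (Real.pi * (m * x)) ≠ 0 := by
  have hc : (Set.range fun j : ℤ => (j : ℝ) / m).Countable := Set.countable_range _
  filter_upwards [hc.ae_notMem MeasureTheory.volume] with x hx h
  obtain ⟨j, hj⟩ := Real.sin_eq_zero_iff.mp h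
  refine hx ⟨j, ?_⟩
  have hm' : (m : ℝ) ≠ 0 := by exact_mod_cast hm.ne'
  have : (j : ℝ) = m * x := mul_left_cancel₀ Real.pi_ne_zero (by linarith)
  simp only [this]
  field_simp

/-- The coefficients of a cusp form of weight `k` along the multiples of `m` have partial sums
`O(N ^ (k / 2 + 1 / 4))`. -/
lemma sumBound_qExpansion_coeff {k : ℤ} (f : CuspForm 𝒮ℒ k) {m : ℕ} (hm : 0 < m) :
    SumBound ((k : ℝ) / 2 + 1 / 4) (fun n => (qExpansion 1 f).coeff (m * n)) := by
  obtain ⟨C, hC⟩ := CuspFormClass.exists_bound f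
  have hC0 : 0 ≤ C := by
    have := (norm_nonneg _).trans (hC UpperHalfPlane.I)
    simpa using this
  set g : ℝ → ℝ := fun x => |Real.sin (Real.pi * (m * x))| ^ (-(3 / 4) : ℝ) with hg
  have hgi : IntervalIntegrable g MeasureTheory.volume 0 1 := by
    have hm' : (m : ℝ) ≠ 0 := by exact_mod_cast hm.ne'
    have := (intervalIntegrable_abs_sin_pi_rpow 0 m).comp_mul_left (c := m)
    rwa [zero_div, div_self hm'] at this
  have hI0 : 0 ≤ ∫ x in (0 : ℝ)..1, g x :=
    intervalIntegral.integral_nonneg zero_le_one fun x _ => by positivity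
  set R : ℝ := Real.exp (2 * Real.pi * m) with hR
  refine ⟨R * C * ∫ x in (0 : ℝ)..1, g x, by positivity, fun N => ?_⟩
  rcases Nat.eq_zero_or_pos N with rfl | hN
  · simp only [zero_le, Finset.Ico_eq_empty_of_le, Finset.sum_empty, norm_zero]
    positivity
  have hN0 : (0 : ℝ) < N := by exact_mod_cast hN
  -- At this height `|q|^(-mN) = exp (2πm)` does not depend on `N`, and the bound on `f` becomes `C
  -- * N^(k/2)`.
  set t : ℝ := 1 / N with ht
  have ht0 : 0 < t := by positivity
  have hsum : ∑ n ∈ Finset.Ico 1 N, (qExpansion 1 f).coeff (m * n) =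
      ∫ x in (0 : ℝ)..1, (∑ n ∈ Finset.Ico 1 N,
        (1 / Function.Periodic.qParam 1 ((x : ℂ) + t * Complex.I) ^ m) ^ n) *
          f ⟨(x : ℂ) + t * Complex.I, by simpa using ht0⟩ := by
    simp_rw [Finset.sum_mul]
    rw [intervalIntegral.integral_finsetSum]
    · refine Finset.sum_congr rfl fun n _ => ?_
      rw [ModularFormClass.qExpansion_coeff_eq_intervalIntegral f one_pos
        one_mem_strictPeriods_SL _ ht0]
      simp only [Complex.ofReal_one, div_one, one_mul, one_div, inv_pow, pow_mul]
    · intro n _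
      apply Continuous.intervalIntegrable
      fun_prop (disch := simp [Function.Periodic.qParam_ne_zero])
  rw [hsum]
  have hbound : ∀ᵐ x : ℝ, x ∈ Set.Ioc (0 : ℝ) 1 → ‖(∑ n ∈ Finset.Ico 1 N,
        (1 / Function.Periodic.qParam 1 ((x : ℂ) + t * Complex.I) ^ m) ^ n) *
          f ⟨(x : ℂ) + t * Complex.I, by simpa using ht0⟩‖ ≤
        R * C * (N : ℝ) ^ ((k : ℝ) / 2 + 1 / 4) * g x := by
    -- At zeros of the sine `rpow` returns `0`, so `g` does not majorize there; these points form a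
    -- null set.
    filter_upwards [ae_sin_pi_mul_ne_zero hm] with x hx _
    have hr1 : 1 ≤ Real.exp (2 * Real.pi * m * t) := Real.one_le_exp (by positivity)
    have hw : ‖1 / Function.Periodic.qParam 1 ((x : ℂ) + t * Complex.I) ^ m‖ =
        Real.exp (2 * Real.pi * m * t) := by
      rw [one_div_qParam_pow, norm_mul, Complex.norm_exp_ofReal_mul_I, mul_one, Complex.norm_real,
        Real.norm_of_nonneg (Real.exp_pos _).le]
    have hD := norm_sum_Ico_pow_le (w := 1 / Function.Periodic.qParam 1 ((x : ℂ) + t * Complex.I) ^ m)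
      (hw ▸ hr1) hN (R := R) (s := |Real.sin (Real.pi * (m * x))|)
      (by
        rw [hw, ← Real.exp_nat_mul, hR, ht]
        refine Real.exp_le_exp.mpr (le_of_eq ?_)
        field_simp)
      (abs_pos.mpr hx)
      (by
        rw [one_div_qParam_pow, ← abs_neg, ← Real.sin_neg]
        exact two_mul_abs_sin_le_norm_sub_one hr1 _)
    have hf := hC ⟨(x : ℂ) + t * Complex.I, by simpa using ht0⟩
    have him : UpperHalfPlane.im ⟨(x : ℂ) + t * Complex.I, by simpa using ht0⟩ = t := by
      simp [← UpperHalfPlane.coe_im]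
    have htk : C / t ^ ((k : ℝ) / 2) = C * (N : ℝ) ^ ((k : ℝ) / 2) := by
      rw [ht, Real.div_rpow zero_le_one hN0.le, Real.one_rpow, div_div_eq_mul_div, div_one]
    rw [him, htk] at hf
    rw [norm_mul]
    refine (mul_le_mul hD hf (norm_nonneg _) (by positivity)).trans (le_of_eq ?_)
    rw [Real.rpow_add hN0]
    ring
  refine (intervalIntegral.norm_integral_le_of_norm_le zero_le_one hbound
    (hgi.const_mul _)).trans (le_of_eq ?_)
  rw [intervalIntegral.integral_const_mul]
  ring

/-! ### Hecke operators on q-expansions -/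

lemma sum_range_exp_pow {d : ℕ} (hd : 0 < d) (l : ℕ) :
    ∑ b ∈ Finset.range d, (Complex.exp (2 * Real.pi * Complex.I / d) ^ l) ^ b =
      if d ∣ l then (d : ℂ) else 0 := by
  have hζ := Complex.isPrimitiveRoot_exp d hd.ne'
  split_ifs with h
  · rw [(hζ.pow_eq_one_iff_dvd l).mpr h]
    simp
  · rw [geom_sum_eq (fun h1 => h ((hζ.pow_eq_one_iff_dvd l).mp h1)), ← pow_mul, mul_comm l d, pow_mul,
      hζ.pow_eq_one, one_pow, sub_self, zero_div]

/-- The representatives of determinant `n` are the matrices `!![a, b; 0, n / a]` with `a ∣ n` and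
`0 ≤ b < n / a`. -/
lemma sum_reps {M : Type*} [AddCommMonoid M] {n : ℕ} (hn : 0 < n) (G : ℕ → ℕ → M) :
    ∑ A : reps (n : ℤ), G (A.1.1 0 0).toNat (A.1.1 0 1).toNat =
      ∑ a ∈ n.divisors, ∑ b ∈ Finset.range (n / a), G a b := by
  have hdet : ∀ A : reps (n : ℤ), A.1.1 0 0 * A.1.1 1 1 = n := fun A => by
    have h := A.1.2
    rw [Matrix.det_fin_two, A.2.1, mul_zero, sub_zero] at h
    exact h
  have hpos : ∀ A : reps (n : ℤ), 0 < A.1.1 1 1 := fun A => by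
    refine pos_of_mul_pos_right (a := A.1.1 0 0) ?_ A.2.2.1.le
    rw [hdet]
    exact_mod_cast hn
  have hdiv : ∀ A : reps (n : ℤ), (A.1.1 0 0).toNat * (A.1.1 1 1).toNat = n := fun A => by
    zify
    rw [Int.toNat_of_nonneg A.2.2.1.le, Int.toNat_of_nonneg (hpos A).le, hdet]
  rw [Finset.sum_sigma']
  refine Finset.sum_bij (fun A _ => ⟨(A.1.1 0 0).toNat, (A.1.1 0 1).toNat⟩) ?_ ?_ ?_ ?_
  · intro A _
    have h0 := A.2.2.1
    have h1 : A.1.1 0 1 < A.1.1 1 1 := by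
      have := A.2.2.2.2
      rwa [abs_of_nonneg A.2.2.2.1, abs_of_pos (hpos A)] at this
    have h2 : n / (A.1.1 0 0).toNat = (A.1.1 1 1).toNat :=
      Nat.div_eq_of_eq_mul_right (by omega) (hdiv A).symm
    simp only [Finset.mem_sigma, Nat.mem_divisors, Finset.mem_range]
    refine ⟨⟨⟨_, (hdiv A).symm⟩, hn.ne'⟩, ?_⟩
    rw [h2]
    have := A.2.2.2.1
    omega
  · intro A _ B _ h
    simp only [Sigma.mk.injEq, heq_eq_eq] at h
    have hA := A.2.2.1
    have hB := B.2.2.1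
    have hA' := A.2.2.2.1
    have hB' := B.2.2.2.1
    have h00 : A.1.1 0 0 = B.1.1 0 0 := by omega
    have h01 : A.1.1 0 1 = B.1.1 0 1 := by omega
    have h11 : A.1.1 1 1 = B.1.1 1 1 := by
      have := (hdet A).trans (hdet B).symm
      rw [h00] at this
      exact mul_left_cancel₀ hB.ne' this
    apply Subtype.ext
    apply FixedDetMatrices.ext
    intro i j
    fin_cases i <;> fin_cases j
    · exact h00
    · exact h01
    · exact A.2.1.trans B.2.1.symm
    · exact h11
  · rintro ⟨a, b⟩ h
    simp only [Finset.mem_sigma, Nat.mem_divisors, Finset.mem_range] at h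
    obtain ⟨⟨⟨d, rfl⟩, -⟩, hb⟩ := h
    have ha : 0 < a := Nat.pos_of_mul_pos_right hn
    rw [Nat.mul_div_cancel_left d ha] at hb
    refine ⟨⟨⟨!![(a : ℤ), b; 0, d], by simp [Matrix.det_fin_two]⟩, ?_⟩, Finset.mem_univ _, ?_⟩
    · refine ⟨by simp, by simpa using ha, by simp, ?_⟩
      simpa using hb
    · simp
  · intro A _
    rfl

/-- The contribution of the matrix `!![a, b; 0, d]` to a Hecke sum. -/
noncomputable def heckeTerm (k : ℤ) (f : ℍ → ℂ) (τ : ℍ) (a d b : ℕ) : ℂ :=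
  ((a * d : ℕ) : ℂ) ^ (k - 1) * (d : ℂ) ^ (-k) * f (ofComplex ((a * (τ : ℂ) + b) / d))

lemma heckeSum_apply {k : ℤ} {n : ℕ} (hn : 0 < n) (f : ℍ → ℂ) (τ : ℍ) :
    heckeSum k n f τ =
      ∑ a ∈ n.divisors, ∑ b ∈ Finset.range (n / a), heckeTerm k f τ a (n / a) b := by
  rw [← sum_reps hn (fun a b => heckeTerm k f τ a (n / a) b), heckeSum, Finset.sum_apply]
  refine Finset.sum_congr rfl fun A _ => ?_
  have h00 := A.2.2.1
  have h01 := A.2.2.2.1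
  have hdet : A.1.1 0 0 * A.1.1 1 1 = n := by
    have h := A.1.2
    rw [Matrix.det_fin_two, A.2.1, mul_zero, sub_zero] at h
    exact h
  have h11 : 0 < A.1.1 1 1 := by
    refine pos_of_mul_pos_right (a := A.1.1 0 0) ?_ h00.le
    rw [hdet]
    exact_mod_cast hn
  have hdiv : (A.1.1 0 0).toNat * (A.1.1 1 1).toNat = n := by
    zify
    rw [Int.toNat_of_nonneg h00.le, Int.toNat_of_nonneg h11.le, hdet]
  have h2 : n / (A.1.1 0 0).toNat = (A.1.1 1 1).toNat :=
    Nat.div_eq_of_eq_mul_right (by omega) hdiv.symm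
  have ca : (((A.1.1 0 0).toNat : ℕ) : ℂ) = ((A.1.1 0 0 : ℤ) : ℂ) := by
    exact_mod_cast congrArg (Int.cast : ℤ → ℂ) (Int.toNat_of_nonneg h00.le)
  have cb : (((A.1.1 0 1).toNat : ℕ) : ℂ) = ((A.1.1 0 1 : ℤ) : ℂ) := by
    exact_mod_cast congrArg (Int.cast : ℤ → ℂ) (Int.toNat_of_nonneg h01)
  have cd : (((A.1.1 1 1).toNat : ℕ) : ℂ) = ((A.1.1 1 1 : ℤ) : ℂ) := by
    exact_mod_cast congrArg (Int.cast : ℤ → ℂ) (Int.toNat_of_nonneg h11.le)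
  have hm := ne_zero_of_mem_reps A
  have hpos : 0 < (toGL hm A.1).det.val := by
    rw [toGL_det]
    exact_mod_cast hn
  have hden : denom (toGL hm A.1) τ = ((A.1.1 1 1 : ℤ) : ℂ) := by
    simp [denom, toGL_apply, A.2.1]
  have hsmul : ((toGL hm A.1 • τ : ℍ) : ℂ) =
      (((A.1.1 0 0 : ℤ) : ℂ) * τ + ((A.1.1 0 1 : ℤ) : ℂ)) / ((A.1.1 1 1 : ℤ) : ℂ) := by
    rw [coe_smul_of_det_pos hpos, hden]
    simp [num, toGL_apply]
  rw [ModularForm.slash_apply, σ, if_pos hpos, hden, toGL_det, heckeTerm, h2, hdiv, ca, cb, cd,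
    ← hsmul, ofComplex_apply]
  have : |((n : ℤ) : ℝ)| = (n : ℝ) := by simp
  rw [this]
  simp only [ContinuousAlgEquiv.refl_apply, Complex.ofReal_natCast]
  ring

/-- Summing over `b` is a sum over `d`-th roots of unity, which keeps only the exponents `l = d *
l'`. Since `q(aτ/d)^d = q(τ)^a`, the coefficient of index `d * l'` moves to the exponent `a * l'`.
-/
lemma hasSum_sum_heckeTerm {k : ℤ} (f : CuspForm 𝒮ℒ k) (τ : ℍ) {a d : ℕ} (ha : 0 < a)
    (hd : 0 < d) :
    HasSum (fun m => (if a ∣ m then (a : ℂ) ^ (k - 1) * (qExpansion 1 f).coeff (d * (m / a)) else 0)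
      * Function.Periodic.qParam 1 τ ^ m) (∑ b ∈ Finset.range d, heckeTerm k f τ a d b) := by
  have ha' : (a : ℂ) ≠ 0 := by exact_mod_cast ha.ne'
  have hd' : (d : ℂ) ≠ 0 := by exact_mod_cast hd.ne'
  have him : ∀ b : ℕ, 0 < ((a * (τ : ℂ) + b) / d).im := fun b => by
    rw [show (a * (τ : ℂ) + b) / d = ((1 / d : ℝ) : ℂ) * (((a : ℝ) : ℂ) * τ + b) by
      push_cast; ring, Complex.im_ofReal_mul]
    simp only [Complex.add_im, Complex.im_ofReal_mul, Complex.natCast_im, add_zero]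
    have := τ.im_pos
    have : (0 : ℝ) < a := by exact_mod_cast ha
    have : (0 : ℝ) < d := by exact_mod_cast hd
    rw [UpperHalfPlane.coe_im]
    positivity
  have hq : ∀ b : ℕ, Function.Periodic.qParam 1 ((a * (τ : ℂ) + b) / d) =
      Function.Periodic.qParam 1 (a * τ / d) * Complex.exp (2 * Real.pi * Complex.I / d) ^ b := by
    intro b
    rw [Function.Periodic.qParam, Function.Periodic.qParam, ← Complex.exp_nat_mul,
      ← Complex.exp_add]
    congr 1
    push_cast
    ring
  have hqd : Function.Periodic.qParam 1 (a * τ / d) ^ d = Function.Periodic.qParam 1 τ ^ a := by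
    rw [Function.Periodic.qParam, Function.Periodic.qParam, ← Complex.exp_nat_mul,
      ← Complex.exp_nat_mul]
    congr 1
    push_cast
    field_simp
  have h1 : HasSum (fun l => ∑ b ∈ Finset.range d,
      ((a * d : ℕ) : ℂ) ^ (k - 1) * (d : ℂ) ^ (-k) * ((qExpansion 1 f).coeff l *
        Function.Periodic.qParam 1 ((a * (τ : ℂ) + b) / d) ^ l))
      (∑ b ∈ Finset.range d, heckeTerm k f τ a d b) := by
    refine hasSum_sum fun b _ => ?_
    rw [heckeTerm, ofComplex_apply_of_im_pos (him b)]
    exact (ModularForm.hasSum_qExpansion f one_pos one_mem_strictPeriods_SL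
      ⟨(a * (τ : ℂ) + b) / d, him b⟩).mul_left _
  have h2 : ∀ l, ∑ b ∈ Finset.range d,
      ((a * d : ℕ) : ℂ) ^ (k - 1) * (d : ℂ) ^ (-k) * ((qExpansion 1 f).coeff l *
        Function.Periodic.qParam 1 ((a * (τ : ℂ) + b) / d) ^ l) =
      if d ∣ l then (a : ℂ) ^ (k - 1) * ((qExpansion 1 f).coeff l *
        Function.Periodic.qParam 1 (a * τ / d) ^ l) else 0 := by
    intro l
    have h3 : ∀ b : ℕ, ((a * d : ℕ) : ℂ) ^ (k - 1) * (d : ℂ) ^ (-k) * ((qExpansion 1 f).coeff l *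
        Function.Periodic.qParam 1 ((a * (τ : ℂ) + b) / d) ^ l) =
        ((a * d : ℕ) : ℂ) ^ (k - 1) * (d : ℂ) ^ (-k) * ((qExpansion 1 f).coeff l *
          Function.Periodic.qParam 1 (a * τ / d) ^ l) *
          (Complex.exp (2 * Real.pi * Complex.I / d) ^ l) ^ b := by
      intro b
      rw [hq, mul_pow, pow_right_comm]
      ring
    rw [Finset.sum_congr rfl fun b _ => h3 b, ← Finset.mul_sum, sum_range_exp_pow hd]
    split_ifs
    -- The last factor `d` is the value of the root-of-unity sum.
    · have h4 : ((a * d : ℕ) : ℂ) ^ (k - 1) * (d : ℂ) ^ (-k) * d = (a : ℂ) ^ (k - 1) := by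
        rw [Nat.cast_mul, mul_zpow, zpow_sub_one₀ hd', _root_.zpow_neg]
        have := zpow_ne_zero k hd'
        field_simp
      rw [← h4]
      ring
    · rw [mul_zero]
  simp_rw [h2] at h1
  rw [← Function.Injective.hasSum_iff (g := fun l => d * l)
    (mul_right_injective₀ hd.ne')] at h1
  swap
  · intro l hl
    refine if_neg fun ⟨c, hc⟩ => hl ⟨c, hc.symm⟩
  rw [← Function.Injective.hasSum_iff (g := fun l => a * l) (mul_right_injective₀ ha.ne')]
  swap
  · intro l hl
    rw [if_neg fun ⟨c, hc⟩ => hl ⟨c, hc.symm⟩, zero_mul]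
  refine h1.congr_fun ?_
  intro l
  simp only [Function.comp_apply, dvd_mul_right, if_true, Nat.mul_div_cancel_left l ha]
  rw [pow_mul, pow_mul _ d l, hqd, mul_assoc]

/-- The coefficients of the image of a cusp form under the `n`-th (unnormalized) Hecke operator. -/
lemma qExpansion_heckeCuspForm_coeff {k : ℤ} (f : CuspForm 𝒮ℒ k) {n : ℕ} (hn : 0 < n) (m : ℕ) :
    (qExpansion 1 (heckeCuspForm n f)).coeff m =
      ∑ a ∈ n.divisors,
        if a ∣ m then (a : ℂ) ^ (k - 1) * (qExpansion 1 f).coeff (n / a * (m / a)) else 0 := by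
  symm
  refine ModularFormClass.qExpansion_coeff_unique (f := heckeCuspForm n f) one_pos
    one_mem_strictPeriods_SL (c := fun m => ∑ a ∈ n.divisors,
      if a ∣ m then (a : ℂ) ^ (k - 1) * (qExpansion 1 f).coeff (n / a * (m / a)) else 0)
    (fun τ => ?_) m
  change HasSum _ (heckeSum k n f τ)
  rw [heckeSum_apply hn]
  simp_rw [smul_eq_mul, Finset.sum_mul]
  refine hasSum_sum fun a ha => ?_
  exact hasSum_sum_heckeTerm f τ (Nat.pos_of_mem_divisors ha)
    (Nat.div_pos (Nat.divisor_le ha) (Nat.pos_of_mem_divisors ha))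

/-! ### From coefficients to the trace -/

instance finiteDimensional_cuspSpace (k : ℤ) : FiniteDimensional ℂ (CuspSpace k) :=
  FiniteDimensional.of_injective CuspForm.toModularFormₗ CuspForm.toModularFormₗ_injective

/-- The linear map sending a cusp form to its coefficients of index `1, …, M`. -/
noncomputable def coeffMap (k : ℤ) (M : ℕ) : CuspSpace k →ₗ[ℂ] (Fin M → ℂ) where
  toFun f j := (qExpansion 1 f).coeff (j + 1 : ℕ)
  map_add' f g := by
    ext j
    simpa using congrArg (PowerSeries.coeff (j + 1 : ℕ))
      (ModularForm.qExpansion_add one_pos one_mem_strictPeriods_SL f g)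
  map_smul' c f := by
    ext j
    simpa using congrArg (PowerSeries.coeff (j + 1 : ℕ))
      (ModularForm.qExpansion_smul one_pos one_mem_strictPeriods_SL c f)

/-- The constant term vanishes by cuspidality, so a form in the kernel vanishes at infinity to order
beyond the Sturm bound. -/
lemma coeffMap_ker (k : ℤ) : LinearMap.ker (coeffMap k (k.toNat / 12)) = ⊥ := by
  rw [LinearMap.ker_eq_bot']
  intro f hf
  apply CuspForm.toModularFormₗ_injective
  rw [map_zero]
  refine ModularForm.sturm_bound_levelOne ?_
  refine lt_of_lt_of_le ?_ (PowerSeries.nat_le_order _ (k.toNat / 12 + 1) fun i hi => ?_)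
  · exact_mod_cast Nat.lt_succ_self _
  · change (qExpansion 1 f).coeff i = 0
    rcases i with _ | i
    · exact CuspFormClass.qExpansion_coeff_zero f one_pos one_mem_strictPeriods_SL
    · exact congrFun hf ⟨i, by omega⟩

/-- Every linear functional on `S_k` is a linear combination of the coefficients of positive
index. -/
lemma exists_functional_eq_sum {k : ℤ} (φ : CuspSpace k →ₗ[ℂ] ℂ) :
    ∃ (M : ℕ) (c : Fin M → ℂ), ∀ f : CuspSpace k,
      φ f = ∑ j, c j * (qExpansion 1 f).coeff (j + 1 : ℕ) := by
  -- A functional `φ` factors as `(φ ∘ g)` after the coefficient map, and is then expanded in the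
  -- standard basis.
  obtain ⟨g, hg⟩ := LinearMap.exists_leftInverse_of_injective _ (coeffMap_ker k)
  refine ⟨_, fun j => φ (g fun i => if j = i then 1 else 0), fun f => ?_⟩
  have h : φ f = (φ ∘ₗ g) (coeffMap k (k.toNat / 12) f) := by
    have := LinearMap.congr_fun hg f
    simp only [LinearMap.comp_apply, LinearMap.id_apply] at this ⊢
    rw [this]
  rw [h, LinearMap.pi_apply_eq_sum_univ]
  refine Finset.sum_congr rfl fun j _ => ?_
  rw [smul_eq_mul, mul_comm]
  rfl

/-- The common divisors of `m` and `n` can be enumerated as divisors of the fixed `m`. The sequence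
in `n` is then a fixed finite combination of dilates by `a` of coefficient sequences along multiples
of `m / a`. -/
lemma sumBound_qExpansion_heckeCuspForm_coeff {k : ℤ} (hk : 0 ≤ k) (f : CuspForm 𝒮ℒ k) {m : ℕ}
    (hm : 0 < m) :
    SumBound ((k : ℝ) / 2 + 1 / 4) (fun n => (qExpansion 1 (heckeCuspForm n f)).coeff m) := by
  have hk' : (0 : ℝ) ≤ k := by exact_mod_cast hk
  have h : SumBound ((k : ℝ) / 2 + 1 / 4) (fun n => ∑ a ∈ m.divisors, (a : ℂ) ^ (k - 1) *
      (if a ∣ n then (qExpansion 1 f).coeff (m / a * (n / a)) else 0)) := by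
    refine SumBound.sum fun a ha => SumBound.const_mul ?_ _
    have ha0 := Nat.pos_of_mem_divisors ha
    exact (sumBound_qExpansion_coeff f (Nat.div_pos (Nat.divisor_le ha) ha0)).dilate
      (by positivity) ha0
  refine h.congr fun n hn => ?_
  rw [qExpansion_heckeCuspForm_coeff f hn, ← Finset.sum_filter]
  simp_rw [mul_ite, mul_zero]
  rw [← Finset.sum_filter]
  refine Finset.sum_congr ?_ fun a _ => by rw [mul_comm (m / a)]
  ext a
  simp only [Finset.mem_filter, Nat.mem_divisors]
  constructor
  · rintro ⟨⟨h1, -⟩, h2⟩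
    exact ⟨⟨h2, hm.ne'⟩, h1⟩
  · rintro ⟨⟨h1, -⟩, h2⟩
    exact ⟨⟨h2, by omega⟩, h1⟩

/-- The traces of the normalized Hecke operators have partial sums `O(N ^ (3 / 4))`. -/
lemma sumBound_trace_heckeOperator {k : ℤ} (hk : 1 ≤ k) :
    SumBound (3 / 4) (fun n => LinearMap.trace ℂ (CuspSpace k) (heckeOperator k n)) := by
  have hk' : (1 : ℝ) ≤ k := by exact_mod_cast hk
  let b := Module.finBasis ℂ (CuspSpace k)
  have hcoord : ∀ i, SumBound ((k : ℝ) / 2 + 1 / 4)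
      (fun n => b.coord i (heckeCuspForm n (b i))) := by
    intro i
    obtain ⟨M, c, hc⟩ := exists_functional_eq_sum (b.coord i)
    simp_rw [hc]
    exact SumBound.sum fun j _ =>
      (sumBound_qExpansion_heckeCuspForm_coeff (by omega) (b i) j.succ_pos).const_mul _
  -- The unnormalized diagonal entries are summed first; the weight `n^(-(k-1)/2)` lowers the
  -- exponent `k/2 + 1/4` to `3/4`.
  have h := (SumBound.sum (s := Finset.univ) fun i _ => hcoord i).rpow_mul
    (s := ((k : ℝ) - 1) / 2) (by linarith) (by linarith) (by linarith)
  rw [show (k : ℝ) / 2 + 1 / 4 - ((k : ℝ) - 1) / 2 = 3 / 4 by ring] at h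
  refine h.congr fun n _ => ?_
  rw [LinearMap.trace_eq_matrix_trace ℂ b, Matrix.trace, Finset.mul_sum]
  refine Finset.sum_congr rfl fun i _ => ?_
  rw [Matrix.diag_apply, LinearMap.toMatrix_apply, ← Module.Basis.coord_apply]
  exact map_smul (b.coord i) (((n : ℝ) ^ (-(((k : ℝ) - 1) / 2)) : ℝ) : ℂ) (heckeCuspForm n (b i))

end HeckeLevelOne

theorem theorem1p1 (k : ℤ) (hk : 3 ≤ k) (ε : ℝ) (hε : 0 < ε) :
    ∃ C : ℝ, ∀ X : ℝ, 0 < X →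
      ‖∑ n ∈ Finset.Ico 1 ⌈X⌉₊,
          LinearMap.trace ℂ (HeckeLevelOne.CuspSpace k) (HeckeLevelOne.heckeOperator k n)‖ ≤
        C * X ^ ((31 : ℝ) / 32 + ε) := by
  obtain ⟨C, hC, h⟩ := HeckeLevelOne.sumBound_trace_heckeOperator (k := k) (by omega)
  refine ⟨C * 2 ^ (3 / 4 : ℝ), fun X hX => ?_⟩
  -- For `X ≤ 1` the sum is empty. Both `⌈X⌉₊ ≤ 2 * X` and the passage to the larger exponent rely
  -- on `X > 1`.
  rcases le_or_gt X 1 with hX1 | hX1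
  · have : ⌈X⌉₊ ≤ 1 := Nat.ceil_le.mpr (by exact_mod_cast hX1)
    rw [Finset.Ico_eq_empty_of_le this, Finset.sum_empty, norm_zero]
    positivity
  · have hceil : ((⌈X⌉₊ : ℕ) : ℝ) ≤ 2 * X := by
      have := Nat.ceil_lt_add_one hX.le
      linarith
    calc _ ≤ C * ((⌈X⌉₊ : ℕ) : ℝ) ^ (3 / 4 : ℝ) := h _
      _ ≤ C * (2 * X) ^ (3 / 4 : ℝ) := by gcongr
      _ = C * 2 ^ (3 / 4 : ℝ) * X ^ (3 / 4 : ℝ) := by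
          rw [Real.mul_rpow zero_le_two hX.le, mul_assoc]
      _ ≤ C * 2 ^ (3 / 4 : ℝ) * X ^ ((31 : ℝ) / 32 + ε) := by
          gcongr
          · exact hX1.le
          · linarith
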